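/- Let $n,m$ be natural numbers and let $f^L,f^U,g_1,\dots,g_m\colon\mathbb{R}^n\to\mathbb{R}$ be convex with $f^L\le f^U$ on $\mathbb{R}^n$. Consider the interval-valued problem of minimizing $f(x)=[f^L(x),f^U(x)]$ over $X=\{x\in\mathbb{R}^n: g_j(x)\le 0,\ j=1,\dots,m\}$. For closed bounded intervals $A=[a^L,a^U]$, $B=[b^L,b^U]$ put $A-B=[a^L-b^U,a^U-b^L]$, write $A\preceq_{LU}B$ if $a^L\le b^L$ and $a^U\le b^U$, and $A\prec_{LU}B$ if $A\preceq_{LU}B$ and $A\ne B$. Let $\mathcal{E}=[\epsilon^L,\epsilon^U]$ with $0\le\epsilon^L\le\epsilon^U$. A point $x^*\in X$ is an $\mathcal{E}$-$LU$-solution if there is no $x\in X$ with $f(x)\prec_{LU}f(x^*)-\mathcal{E}$. Put $X(x^*,\mathcal{E})=\{x\in\mathbb{R}^n: f(x)\preceq_{LU}f(x^*)-\mathcal{E}\}$. For convex $\varphi\colon\mathbb{R}^n\to\mathbb{R}$ and $\varepsilon\ge0$ let $\varphi^*(v)=\sup_{x}(\langle v,x\rangle-\varphi(x))\in\mathbb{R}\cup\{+\infty\}$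 be its conjugate, $\mathrm{epi}\,\varphi^*=\{(v,r)\in\mathbb{R}^n\times\mathbb{R}:\varphi^*(v)\le r\}$, and $\partial_\varepsilon\varphi(x^*)=\{v:\varphi(x)-\varphi(x^*)\ge\langle v,x-x^*\rangle-\varepsilon\ \ \forall x\in\mathbb{R}^n\}$ its $\varepsilon$-subdifferential. For a set $A$ let $\mathrm{cone}\,A=\{\lambda x:\lambda\ge0,\ x\in\mathrm{conv}\,A\}$. Let $x^*\in X$. Assume that $X\cap X(x^*,\mathcal{E})\ne\emptyset$ and that the closedness condition $(CC_{x^*})$ holds: with $\tilde f^L(x)=f^L(x)-f^L(x^*)+\epsilon^U$ and $\tilde f^U(x)=f^U(x)-f^U(x^*)+\epsilon^L$, the set $$\mathrm{cone}\Big(\bigcup_{j=1}^m\mathrm{epi}\,g_j^*\ \cup\ \mathrm{epi}\,(\tilde f^L)^*\ \cup\ \mathrm{epi}\,(\tilde f^U)^*\Big)$$ is closed in $\mathbb{R}^n\times\mathbb{R}$. Then $x^*$ is an $\mathcal{E}$-$LU$-solution if and only if there exist real numbers $\varepsilon_0,\gamma_1,\gamma_2,\mu_1,\mu_2\ge0$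 and $\varepsilon_j,\lambda_j\ge0$ ($j=1,\dots,m$) such that $$0\in\partial_{\varepsilon_0}(f^L+f^U)(x^*)+\mu_1\,\partial_{\gamma_1}f^L(x^*)+\mu_2\,\partial_{\gamma_2}f^U(x^*)+\sum_{j=1}^m\partial_{\varepsilon_j}(\lambda_jg_j)(x^*)$$ and $$\varepsilon_0+\mu_1\gamma_1+\mu_2\gamma_2+\sum_{j=1}^m\varepsilon_j-(1+\mu_1)\epsilon^U-(1+\mu_2)\epsilon^L\ \le\ \sum_{j=1}^m\lambda_jg_j(x^*).$$ -/

import Mathlib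

open scoped Pointwise

/-- `NonemptyInterval ℝ` is the class of closed bounded intervals `[a^L, a^U]`, `a^L ≤ a^U`, with
`a^L = A.fst` and `a^U = A.snd`; its subtraction is `A - B = [a^L - b^U, a^U - b^L]`.
`LULe A B` is the lower-upper order relation `A ⪯_LU B`. -/
def LULe (A B : NonemptyInterval ℝ) : Prop :=
  A.fst ≤ B.fst ∧ A.snd ≤ B.snd

/-- The relation `A ≺_LU B`. -/
def LULt (A B : NonemptyInterval ℝ) : Prop :=
  LULe A B ∧ A ≠ B

/-- The feasible set `X = {x | g_j(x) ≤ 0, j = 1, …, m}`. -/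
def feasibleSet {n m : ℕ} (g : Fin m → EuclideanSpace ℝ (Fin n) → ℝ) :
    Set (EuclideanSpace ℝ (Fin n)) :=
  {x | ∀ j, g j x ≤ 0}

/-- `xs` is an `ℰ`-`LU`-solution of the problem of minimizing `f` subject to `g_j ≤ 0`. -/
def IsLUSolution {n m : ℕ} (f : EuclideanSpace ℝ (Fin n) → NonemptyInterval ℝ)
    (g : Fin m → EuclideanSpace ℝ (Fin n) → ℝ) (ℰ : NonemptyInterval ℝ)
    (xs : EuclideanSpace ℝ (Fin n)) : Prop :=
  xs ∈ feasibleSet g ∧ ¬ ∃ x ∈ feasibleSet g, LULt (f x) (f xs - ℰ)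

/-- The set `X(xs, ℰ) = {x | f(x) ⪯_LU f(xs) - ℰ}`. -/
def lowerLevelSet {n : ℕ} (f : EuclideanSpace ℝ (Fin n) → NonemptyInterval ℝ)
    (ℰ : NonemptyInterval ℝ) (xs : EuclideanSpace ℝ (Fin n)) : Set (EuclideanSpace ℝ (Fin n)) :=
  {x | LULe (f x) (f xs - ℰ)}

/-- The `ε`-subdifferential at `xs` of a real-valued function. -/
def epsSubdifferential {n : ℕ} (ε : ℝ) (φ : EuclideanSpace ℝ (Fin n) → ℝ)
    (xs : EuclideanSpace ℝ (Fin n)) : Set (EuclideanSpace ℝ (Fin n)) :=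
  {v | ∀ x, inner ℝ v (x - xs) - ε ≤ φ x - φ xs}

/-- The conjugate of a real-valued function, with values in the extended reals. -/
noncomputable def conjugateFun {n : ℕ} (φ : EuclideanSpace ℝ (Fin n) → ℝ)
    (v : EuclideanSpace ℝ (Fin n)) : EReal :=
  ⨆ x, ((inner ℝ v x - φ x : ℝ) : EReal)

/-- The epigraph of an extended-real-valued function. -/
def epigraph {n : ℕ} (ψ : EuclideanSpace ℝ (Fin n) → EReal) :
    Set (EuclideanSpace ℝ (Fin n) × ℝ) :=
  {p | ψ p.1 ≤ (p.2 : EReal)}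

/-- The conical hull `{t • x | t ≥ 0, x ∈ conv A}`. -/
def conicalHull {V : Type*} [AddCommGroup V] [Module ℝ V] (A : Set V) : Set V :=
  {y | ∃ t : ℝ, 0 ≤ t ∧ ∃ x ∈ convexHull ℝ A, y = t • x}

/-- The closedness condition at `xs`: the conical hull of the union of the epigraphs of the
conjugates of the `g_j`, of `f^L - f^L(xs) + ε^U` and of `f^U - f^U(xs) + ε^L` is closed, where
`ℰ = [ε^L, ε^U]`. -/
def ClosednessCondition {n m : ℕ} (f : EuclideanSpace ℝ (Fin n) → NonemptyInterval ℝ)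
    (g : Fin m → EuclideanSpace ℝ (Fin n) → ℝ) (ℰ : NonemptyInterval ℝ)
    (xs : EuclideanSpace ℝ (Fin n)) : Prop :=
  IsClosed (conicalHull
    ((⋃ j, epigraph (conjugateFun (g j))) ∪
      epigraph (conjugateFun fun x => (f x).fst - (f xs).fst + ℰ.snd) ∪
      epigraph (conjugateFun fun x => (f x).snd - (f xs).snd + ℰ.fst)))

/-! On `X ∩ X(x*, ℰ)` both endpoint inequalities hold, so `≺_LU` there amounts to strict inequality
of the endpoint sums. Hence `x*` is a solution iff `φ = f^L + f^U + const` is nonnegative on the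
convex set cut out by `g_j ≤ 0`, `f̃^L ≤ 0`, `f̃^U ≤ 0`. The forward direction is a Farkas lemma,
`ConvexOn.exists_farkas_multipliers`. Separation gives an affine minorant of `φ` that is nonnegative
on this set, and closedness of the cone splits its negative into affine minorants of multiples of
the constraints (`mem_conicalHull_of_affine_le`, `exists_multipliers_of_mem_conicalHull`). Each
minorant is an approximate subgradient whose tolerance is its gap at `x*`. The converse adds the
subgradient inequalities. -/

section ConvexSeparation

variable {E : Type*} [NormedAddCommGroup E] [InnerProductSpace ℝ E] [FiniteDimensional ℝ E]

/-- A continuous linear functional on `E × ℝ` is given by a vector of `E` and a real number. -/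
theorem StrongDual.exists_inner_add_mul (F : StrongDual ℝ (E × ℝ)) :
    ∃ (w : E) (β : ℝ), ∀ x τ, F (x, τ) = inner ℝ w x + β * τ := by
  refine ⟨(InnerProductSpace.toDual ℝ E).symm (F.comp (ContinuousLinearMap.inl ℝ E ℝ)),
    F (0, 1), fun x τ => ?_⟩
  rw [InnerProductSpace.toDual_symm_apply]
  have h : ((x, τ) : E × ℝ) = (x, 0) + τ • (0, 1) := by simp
  rw [h, map_add, map_smul, smul_eq_mul, mul_comm]
  simp

/-- A convex function that is at least `c` on a convex set has an affine minorant that is at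
least `c` on that set. -/
theorem ConvexOn.exists_affine_minorant {φ : E → ℝ} (hφ : ConvexOn ℝ Set.univ φ) {C : Set E}
    (hC : Convex ℝ C) (hne : C.Nonempty) {c : ℝ} (hc : ∀ x ∈ C, c ≤ φ x) :
    ∃ (v : E) (r : ℝ), (∀ x, inner ℝ v x - r ≤ φ x) ∧ ∀ x ∈ C, c ≤ inner ℝ v x - r := by
  have hcont : Continuous φ := continuousOn_univ.1 (hφ.continuousOn isOpen_univ)
  have hopen : IsOpen {p : E × ℝ | p.1 ∈ Set.univ ∧ φ p.1 < p.2} := by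
    simpa using isOpen_lt (hcont.comp continuous_fst) continuous_snd
  have hdisj : Disjoint {p : E × ℝ | p.1 ∈ Set.univ ∧ φ p.1 < p.2} (C ×ˢ Set.Iic c) := by
    rw [Set.disjoint_left]
    rintro ⟨x, τ⟩ ⟨-, h1⟩ ⟨h2, h3⟩
    exact absurd (hc x h2) (not_le.2 (lt_of_lt_of_le h1 h3))
  obtain ⟨F, u, hs, ht⟩ := geometric_hahn_banach_open hφ.convex_strict_epigraph hopen
    (hC.prod (convex_Iic c)) hdisj
  obtain ⟨w, β, hF⟩ := StrongDual.exists_inner_add_mul F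
  have hs' : ∀ x τ, φ x < τ → inner ℝ w x + β * τ < u := fun x τ h => by
    rw [← hF]; exact hs (x, τ) ⟨trivial, h⟩
  have ht' : ∀ x ∈ C, u ≤ inner ℝ w x + β * c := fun x h => by
    rw [← hF]; exact ht (x, c) ⟨h, le_refl c⟩
  obtain ⟨x₀, hx₀⟩ := hne
  -- The hyperplane is not vertical: it strictly separates two points on the vertical line over
  -- `x₀`.
  have hβ : 0 < -β := by
    have h1 := hs' x₀ (φ x₀ + 1) (lt_add_one _)
    have h2 := ht' x₀ hx₀
    have h3 := hc x₀ hx₀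
    by_contra! hneg
    nlinarith
  have hval : ∀ x, inner ℝ ((-β)⁻¹ • w) x - (-β)⁻¹ * u = (inner ℝ w x - u) / -β := fun x => by
    rw [real_inner_smul_left]; ring
  refine ⟨(-β)⁻¹ • w, (-β)⁻¹ * u, fun x => ?_, fun x hx => ?_⟩
  · rw [hval, div_le_iff₀ hβ]
    have : ∀ τ, φ x < τ → (inner ℝ w x - u) / -β ≤ τ := fun τ h => by
      rw [div_le_iff₀ hβ]
      linarith [hs' x τ h]
    exact (div_le_iff₀ hβ).1 (le_of_forall_gt_imp_ge_of_dense this)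
  · rw [hval, le_div_iff₀ hβ]
    linarith [ht' x hx]

/-- A finite convex function has an exact affine minorant at every point. -/
theorem ConvexOn.exists_affine_minorant_eq {φ : E → ℝ} (hφ : ConvexOn ℝ Set.univ φ) (x₀ : E) :
    ∃ (v : E) (r : ℝ), (∀ x, inner ℝ v x - r ≤ φ x) ∧ inner ℝ v x₀ - r = φ x₀ := by
  obtain ⟨v, r, h1, h2⟩ := hφ.exists_affine_minorant (convex_singleton x₀)
    (Set.singleton_nonempty x₀) (c := φ x₀) (by simp)
  exact ⟨v, r, h1, le_antisymm (h1 x₀) (h2 x₀ rfl)⟩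

end ConvexSeparation

/-! ### Conical hulls -/

section ConicalHull

variable {V : Type*} [AddCommGroup V] [Module ℝ V] {A : Set V}

theorem subset_conicalHull : A ⊆ conicalHull A := fun x hx =>
  ⟨1, zero_le_one, x, subset_convexHull ℝ A hx, (one_smul ℝ x).symm⟩

theorem smul_mem_conicalHull {x : V} (hx : x ∈ conicalHull A) {c : ℝ} (hc : 0 ≤ c) :
    c • x ∈ conicalHull A := by
  obtain ⟨t, ht, y, hy, rfl⟩ := hx
  exact ⟨c * t, mul_nonneg hc ht, y, hy, (mul_smul c t y).symm⟩

/-- Renormalizing by `a * t + b * s` gives a multiple of a convex combination; if this total is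
zero, both terms vanish. -/
theorem convex_conicalHull : Convex ℝ (conicalHull A) := by
  rintro _ ⟨t, ht, x, hx, rfl⟩ _ ⟨s, hs, y, hy, rfl⟩ a b ha hb -
  have hat := mul_nonneg ha ht
  have hbs := mul_nonneg hb hs
  rcases (add_nonneg hat hbs).eq_or_lt with h0 | hpos
  · have h1 : a * t = 0 := by linarith
    have h2 : b * s = 0 := by linarith
    exact ⟨0, le_rfl, x, hx, by rw [smul_smul, smul_smul, h1, h2]; simp⟩
  · refine ⟨a * t + b * s, hpos.le,
      (a * t / (a * t + b * s)) • x + (b * s / (a * t + b * s)) • y,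
      convex_convexHull ℝ A hx hy (by positivity) (by positivity) (by field_simp), ?_⟩
    rw [smul_add, smul_smul, smul_smul, smul_smul, smul_smul, mul_div_cancel₀ _ hpos.ne',
      mul_div_cancel₀ _ hpos.ne']

theorem conicalHull_subset {S : Set V} (hAS : A ⊆ S) (hS : Convex ℝ S)
    (hsmul : ∀ x ∈ S, ∀ c : ℝ, 0 ≤ c → c • x ∈ S) : conicalHull A ⊆ S := by
  rintro _ ⟨t, ht, x, hx, rfl⟩
  exact hsmul x (convexHull_min hAS hS hx) t ht

end ConicalHull

/-! ### Farkas lemma and approximate subgradients -/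

section Farkas

variable {n : ℕ}

theorem mem_epigraph_conjugateFun {φ : EuclideanSpace ℝ (Fin n) → ℝ}
    {p : EuclideanSpace ℝ (Fin n) × ℝ} :
    p ∈ epigraph (conjugateFun φ) ↔ ∀ x, inner ℝ p.1 x - p.2 ≤ φ x := by
  simp only [epigraph, conjugateFun, Set.mem_ofPred_eq, iSup_le_iff, EReal.coe_le_coe_iff]
  exact forall_congr' fun x => sub_le_comm

variable {ι : Type*} {G : ι → EuclideanSpace ℝ (Fin n) → ℝ}

/-- An affine inequality valid on `{x | ∀ i, G i x ≤ 0}` belongs to the conical hull of the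
epigraphs of the conjugates, if that cone is closed. -/
theorem mem_conicalHull_of_affine_le [Nonempty ι] (hG : ∀ i, ConvexOn ℝ Set.univ (G i))
    {x₀ : EuclideanSpace ℝ (Fin n)} (hx₀ : ∀ i, G i x₀ ≤ 0)
    (hclosed : IsClosed (conicalHull (⋃ i, epigraph (conjugateFun (G i)))))
    {v : EuclideanSpace ℝ (Fin n)} {r : ℝ}
    (h : ∀ x, (∀ i, G i x ≤ 0) → inner ℝ v x ≤ r) :
    (v, r) ∈ conicalHull (⋃ i, epigraph (conjugateFun (G i))) := by
  by_contra hnot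
  obtain ⟨F, u, hK, hu⟩ := geometric_hahn_banach_closed_point convex_conicalHull hclosed hnot
  obtain ⟨y, s, hF⟩ := StrongDual.exists_inner_add_mul F
  have hepi : ∀ i w τ, (∀ x, inner ℝ w x - τ ≤ G i x) →
      (w, τ) ∈ conicalHull (⋃ i, epigraph (conjugateFun (G i))) := fun i w τ hw =>
    subset_conicalHull (Set.mem_iUnion.2 ⟨i, mem_epigraph_conjugateFun.2 hw⟩)
  -- A functional bounded above on a cone is nonpositive there.
  have hnonpos : ∀ i w τ, (∀ x, inner ℝ w x - τ ≤ G i x) → inner ℝ y w + s * τ ≤ 0 := by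
    intro i w τ hw
    by_contra! hpos
    have h1 := hK _ (smul_mem_conicalHull (hepi i w τ hw)
      (div_nonneg (abs_nonneg u) hpos.le))
    rw [map_smul, hF, smul_eq_mul, div_mul_cancel₀ _ hpos.ne'] at h1
    exact absurd (le_abs_self u) (not_le.2 h1)
  obtain ⟨i₀⟩ := ‹Nonempty ι›
  obtain ⟨w₀, τ₀, hw₀, -⟩ := (hG i₀).exists_affine_minorant_eq 0
  have hupos : 0 < u := by
    simpa using hK _ (smul_mem_conicalHull (hepi i₀ w₀ τ₀ hw₀) le_rfl)
  -- Epigraphs are unbounded upwards.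
  have hs : s ≤ 0 := by
    by_contra! hpos
    have h1 := hnonpos i₀ w₀ (τ₀ + (|inner ℝ y w₀ + s * τ₀| + 1) / s) fun x => by
      have : 0 ≤ (|inner ℝ y w₀ + s * τ₀| + 1) / s := by positivity
      linarith [hw₀ x]
    rw [mul_add, mul_div_cancel₀ _ hpos.ne'] at h1
    linarith [neg_abs_le (inner ℝ y w₀ + s * τ₀)]
  have hvr : 0 < inner ℝ y v + s * r := by rw [← hF]; exact hupos.trans hu
  -- Since `s = 0` is possible, `(y, s)` is perturbed by `δ • (x₀, -1)`, which is nonpositive on the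
  -- epigraphs because `x₀` is feasible. For small `δ` the value at `(v, r)` stays positive, and
  -- dividing by `δ - s > 0` yields a feasible point violating `h`.
  obtain ⟨δ, hδ, hδ'⟩ : ∃ δ : ℝ, 0 < δ ∧
      0 < inner ℝ y v + s * r + δ * (inner ℝ x₀ v - r) := by
    refine ⟨(inner ℝ y v + s * r) / (2 * (|inner ℝ x₀ v - r| + 1)), by positivity, ?_⟩
    set a := inner ℝ y v + s * r
    set b := inner ℝ x₀ v - r
    have hb : 0 < |b| + 1 := by positivity
    have h1 : a / (2 * (|b| + 1)) * -(|b| + 1) ≤ a / (2 * (|b| + 1)) * b :=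
      mul_le_mul_of_nonneg_left (by linarith [neg_abs_le b]) (by positivity)
    have h2 : a / (2 * (|b| + 1)) * -(|b| + 1) = -(a / 2) := by field_simp
    linarith
  have hσ : 0 < δ - s := by linarith
  have hfeas : ∀ i, G i ((δ - s)⁻¹ • (y + δ • x₀)) ≤ 0 := by
    intro i
    obtain ⟨w, τ, hw, heq⟩ := (hG i).exists_affine_minorant_eq ((δ - s)⁻¹ • (y + δ • x₀))
    have h1 := hnonpos i w τ hw
    have h2 := (hw x₀).trans (hx₀ i)
    rw [← heq, real_inner_smul_right, inner_add_right, real_inner_smul_right, sub_nonpos,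
      inv_mul_le_iff₀ hσ, real_inner_comm]
    nlinarith
  have h3 := h _ hfeas
  rw [real_inner_smul_right, inner_add_right, real_inner_smul_right, inv_mul_le_iff₀ hσ,
    real_inner_comm, real_inner_comm x₀] at h3
  nlinarith

/-- Elements of the conical hull of the epigraphs of the conjugates are sums of elements of the
epigraphs of the conjugates of nonnegative multiples. -/
theorem exists_multipliers_of_mem_conicalHull [Fintype ι]
    {p : EuclideanSpace ℝ (Fin n) × ℝ}
    (hp : p ∈ conicalHull (⋃ i, epigraph (conjugateFun (G i)))) :
    ∃ (lam : ι → ℝ) (w : ι → EuclideanSpace ℝ (Fin n)) (τ : ι → ℝ),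
      (∀ i, 0 ≤ lam i) ∧ (∀ i x, inner ℝ (w i) x - τ i ≤ lam i * G i x) ∧
      ∑ i, w i = p.1 ∧ ∑ i, τ i = p.2 := by
  classical
  have hcomb : ∀ {l w t l' w' t' : ℝ} {a b y y' : ℝ}, 0 ≤ a → 0 ≤ b → w - t ≤ l * y →
      w' - t' ≤ l' * y' → a * w + b * w' - (a * t + b * t') ≤ a * (l * y) + b * (l' * y') := by
    intro l w t l' w' t' a b y y' ha hb h h'
    linarith [mul_le_mul_of_nonneg_left h ha, mul_le_mul_of_nonneg_left h' hb]
  -- The decomposable pairs form a convex cone containing every epigraph.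
  refine conicalHull_subset (S := {p | ∃ (lam : ι → ℝ) (w : ι → EuclideanSpace ℝ (Fin n))
      (τ : ι → ℝ), (∀ i, 0 ≤ lam i) ∧ (∀ i x, inner ℝ (w i) x - τ i ≤ lam i * G i x) ∧
      ∑ i, w i = p.1 ∧ ∑ i, τ i = p.2}) ?_ ?_ ?_ hp
  · rintro ⟨w, τ⟩ hq
    obtain ⟨i, hi⟩ := Set.mem_iUnion.1 hq
    rw [mem_epigraph_conjugateFun] at hi
    refine ⟨Pi.single i 1, Pi.single i w, Pi.single i τ, fun j => ?_, fun j x => ?_, ?_, ?_⟩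
    · rcases eq_or_ne j i with rfl | hj <;> simp [*]
    · rcases eq_or_ne j i with rfl | hj
      · simpa using hi x
      · simp [hj]
    · simp
    · simp
  · rintro _ ⟨l, w, τ, hl, hw, h1, h2⟩ _ ⟨l', w', τ', hl', hw', h1', h2'⟩ a b ha hb -
    refine ⟨a • l + b • l', a • w + b • w', a • τ + b • τ', fun i => ?_, fun i x => ?_, ?_, ?_⟩
    · exact add_nonneg (mul_nonneg ha (hl i)) (mul_nonneg hb (hl' i))
    · simp only [Pi.add_apply, Pi.smul_apply, smul_eq_mul, inner_add_left, real_inner_smul_left]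
      linarith [hcomb ha hb (hw i x) (hw' i x)]
    · simp [Finset.sum_add_distrib, ← Finset.smul_sum, h1, h1']
    · simp [Finset.sum_add_distrib, ← Finset.mul_sum, h2, h2']
  · rintro _ ⟨l, w, τ, hl, hw, h1, h2⟩ c hc
    refine ⟨c • l, c • w, c • τ, fun i => mul_nonneg hc (hl i), fun i x => ?_, ?_, ?_⟩
    · simp only [Pi.smul_apply, smul_eq_mul, real_inner_smul_left]
      linarith [mul_le_mul_of_nonneg_left (hw i x) hc]
    · simp [← Finset.smul_sum, h1]
    · simp [← Finset.mul_sum, h2]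

/-- Farkas lemma for convex systems with a closed characteristic cone. -/
theorem ConvexOn.exists_farkas_multipliers [Fintype ι] [Nonempty ι]
    {φ : EuclideanSpace ℝ (Fin n) → ℝ} (hφ : ConvexOn ℝ Set.univ φ)
    (hG : ∀ i, ConvexOn ℝ Set.univ (G i)) (hne : ∃ x, ∀ i, G i x ≤ 0)
    (hclosed : IsClosed (conicalHull (⋃ i, epigraph (conjugateFun (G i)))))
    (h : ∀ x, (∀ i, G i x ≤ 0) → 0 ≤ φ x) :
    ∃ (v : EuclideanSpace ℝ (Fin n)) (r : ℝ) (lam : ι → ℝ)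
      (w : ι → EuclideanSpace ℝ (Fin n)) (τ : ι → ℝ),
      (∀ i, 0 ≤ lam i) ∧ (∀ x, inner ℝ v x - r ≤ φ x) ∧
      (∀ i x, inner ℝ (w i) x - τ i ≤ lam i * G i x) ∧
      v + ∑ i, w i = 0 ∧ r + ∑ i, τ i = 0 := by
  obtain ⟨x₀, hx₀⟩ := hne
  have hconv : Convex ℝ {x | ∀ i, G i x ≤ 0} := by
    rw [Set.ofPred_forall]
    exact convex_iInter fun i => by simpa using (hG i).convex_le 0
  obtain ⟨v, r, hv, hv'⟩ := hφ.exists_affine_minorant hconv ⟨x₀, hx₀⟩ h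
  obtain ⟨lam, w, τ, h1, h2, h3, h4⟩ := exists_multipliers_of_mem_conicalHull
    (mem_conicalHull_of_affine_le hG hx₀ hclosed (v := -v) (r := -r) fun x hx => by
      rw [inner_neg_left]; linarith [hv' x hx])
  exact ⟨v, r, lam, w, τ, h1, hv, h2, by rw [h3]; simp, by rw [h4]; simp⟩

/-- An affine minorant of `φ` is an `ε`-subgradient, `ε` being its gap at the base point. -/
theorem mem_epsSubdifferential_of_affine_le {φ : EuclideanSpace ℝ (Fin n) → ℝ}
    {v : EuclideanSpace ℝ (Fin n)} {r : ℝ} (h : ∀ x, inner ℝ v x - r ≤ φ x)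
    (x₀ : EuclideanSpace ℝ (Fin n)) :
    v ∈ epsSubdifferential (r + φ x₀ - inner ℝ v x₀) φ x₀ := fun x => by
  rw [inner_sub_right]
  linarith [h x]

/-- An affine minorant of `μ * (φ + c)` is `μ` times an approximate subgradient of `φ`. -/
theorem exists_mem_smul_epsSubdifferential {φ : EuclideanSpace ℝ (Fin n) → ℝ}
    (hφ : ConvexOn ℝ Set.univ φ) {μ c r : ℝ} (hμ : 0 ≤ μ) {v : EuclideanSpace ℝ (Fin n)}
    (h : ∀ x, inner ℝ v x - r ≤ μ * (φ x + c)) (x₀ : EuclideanSpace ℝ (Fin n)) :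
    ∃ γ, 0 ≤ γ ∧ μ * γ ≤ r + μ * (φ x₀ + c) - inner ℝ v x₀ ∧
      v ∈ μ • epsSubdifferential γ φ x₀ := by
  rcases hμ.eq_or_lt with rfl | hpos
  -- For `μ = 0` the bound forces `v = 0`; an exact subgradient `w` is still needed, since `0 • ∅`
  -- is empty.
  · obtain ⟨w, t, hw, heq⟩ := hφ.exists_affine_minorant_eq x₀
    have hv : v = 0 := by
      by_contra hv0
      have hvv : 0 < inner ℝ v v := real_inner_self_pos.2 hv0
      have := h (((|r| + 1) / inner ℝ v v) • v)
      rw [real_inner_smul_right, div_mul_cancel₀ _ hvv.ne'] at this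
      linarith [le_abs_self r]
    refine ⟨0, le_rfl, by linarith [h x₀], w, fun x => ?_, by simp [hv]⟩
    rw [inner_sub_right]
    linarith [hw x]
  · refine ⟨(r + μ * (φ x₀ + c) - inner ℝ v x₀) / μ, div_nonneg (by linarith [h x₀]) hμ,
      (mul_div_cancel₀ _ hpos.ne').le, μ⁻¹ • v, fun x => ?_, ?_⟩
    · rw [real_inner_smul_left, inner_sub_right, ← div_eq_inv_mul, ← sub_div, div_le_iff₀ hpos]
      linarith [h x]
    · simp [smul_smul, hpos.ne']

end Farkas

/-! ### Scalarization and the optimality condition -/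

/-- A feasible point is an `ℰ`-`LU`-solution iff the sum of the shifted objectives is nonnegative
at the feasible points of the lower level set. -/
theorem isLUSolution_iff_sum_nonneg {n m : ℕ} {f : EuclideanSpace ℝ (Fin n) → NonemptyInterval ℝ}
    {g : Fin m → EuclideanSpace ℝ (Fin n) → ℝ} {ℰ : NonemptyInterval ℝ}
    {xs : EuclideanSpace ℝ (Fin n)} (hxs : xs ∈ feasibleSet g) :
    IsLUSolution f g ℰ xs ↔ ∀ x ∈ feasibleSet g, (f x).fst ≤ (f xs).fst - ℰ.snd →
      (f x).snd ≤ (f xs).snd - ℰ.fst →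
      0 ≤ (f x).fst + (f x).snd + (ℰ.fst + ℰ.snd - (f xs).fst - (f xs).snd) := by
  constructor
  · rintro ⟨-, h⟩ x hx h1 h2
    by_contra! hneg
    refine h ⟨x, hx, ⟨h1, h2⟩, fun heq => ?_⟩
    rw [heq, NonemptyInterval.fst_sub, NonemptyInterval.snd_sub] at hneg
    linarith
  · rintro h
    refine ⟨hxs, ?_⟩
    rintro ⟨x, hx, ⟨h1, h2⟩, hne⟩
    rw [NonemptyInterval.fst_sub] at h1
    rw [NonemptyInterval.snd_sub] at h2
    have h3 := h x hx h1 h2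
    refine hne (NonemptyInterval.ext (Prod.ext ?_ ?_))
    · change (f x).fst = (f xs - ℰ).fst
      rw [NonemptyInterval.fst_sub]
      linarith
    · change (f x).snd = (f xs - ℰ).snd
      rw [NonemptyInterval.snd_sub]
      linarith

theorem mainTheorem4 (n m : ℕ) (f : EuclideanSpace ℝ (Fin n) → NonemptyInterval ℝ)
    (g : Fin m → EuclideanSpace ℝ (Fin n) → ℝ)
    (hfL : ConvexOn ℝ Set.univ (fun x => (f x).fst))
    (hfU : ConvexOn ℝ Set.univ (fun x => (f x).snd))
    (hg : ∀ j, ConvexOn ℝ Set.univ (g j))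
    (ℰ : NonemptyInterval ℝ) (hℰ : 0 ≤ ℰ.fst)
    (xs : EuclideanSpace ℝ (Fin n)) (hxs : xs ∈ feasibleSet g)
    (hne : (feasibleSet g ∩ lowerLevelSet f ℰ xs).Nonempty)
    (hCC : ClosednessCondition f g ℰ xs) :
    IsLUSolution f g ℰ xs ↔
      ∃ (ε₀ γ₁ γ₂ μ₁ μ₂ : ℝ) (ε lam : Fin m → ℝ),
        0 ≤ ε₀ ∧ 0 ≤ γ₁ ∧ 0 ≤ γ₂ ∧ 0 ≤ μ₁ ∧ 0 ≤ μ₂ ∧ (∀ j, 0 ≤ ε j) ∧ (∀ j, 0 ≤ lam j) ∧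
        (0 : EuclideanSpace ℝ (Fin n)) ∈
          epsSubdifferential ε₀ (fun x => (f x).fst + (f x).snd) xs +
            μ₁ • epsSubdifferential γ₁ (fun x => (f x).fst) xs +
            μ₂ • epsSubdifferential γ₂ (fun x => (f x).snd) xs +
            ∑ j, epsSubdifferential (ε j) (fun x => lam j * g j x) xs ∧
        ε₀ + μ₁ * γ₁ + μ₂ * γ₂ + (∑ j, ε j) - (1 + μ₁) * ℰ.snd - (1 + μ₂) * ℰ.fst
          ≤ ∑ j, lam j * g j xs := by
  rw [isLUSolution_iff_sum_nonneg hxs]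
  constructor
  · intro h
    -- `true` indexes `f̃^L`, `false` indexes `f̃^U`.
    let G : Fin m ⊕ Bool → EuclideanSpace ℝ (Fin n) → ℝ := Sum.elim g fun b x =>
      cond b ((f x).fst + (ℰ.snd - (f xs).fst)) ((f x).snd + (ℰ.fst - (f xs).snd))
    have hG : ∀ i, ConvexOn ℝ Set.univ (G i) := by
      rintro (j | _ | _)
      · exact hg j
      · exact hfU.add (convexOn_const _ convex_univ)
      · exact hfL.add (convexOn_const _ convex_univ)
    have hG_nonpos : ∀ x, (∀ i, G i x ≤ 0) ↔ x ∈ feasibleSet g ∧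
        (f x).fst ≤ (f xs).fst - ℰ.snd ∧ (f x).snd ≤ (f xs).snd - ℰ.fst := by
      intro x
      simp only [Sum.forall, Bool.forall_bool, G, Sum.elim_inl, Sum.elim_inr, cond_true,
        cond_false, feasibleSet, Set.mem_ofPred_eq]
      refine and_congr_right fun _ => ⟨fun h => ⟨?_, ?_⟩, fun h => ⟨?_, ?_⟩⟩ <;>
        linarith [h.1, h.2]
    have hclosed : IsClosed (conicalHull (⋃ i, epigraph (conjugateFun (G i)))) := by
      have hL : (fun x => (f x).fst - (f xs).fst + ℰ.snd) = G (Sum.inr true) := by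
        funext x; simp only [G, Sum.elim_inr, cond_true]; ring
      have hU : (fun x => (f x).snd - (f xs).snd + ℰ.fst) = G (Sum.inr false) := by
        funext x; simp only [G, Sum.elim_inr, cond_false]; ring
      have hunion : (⋃ i, epigraph (conjugateFun (G i))) =
          (⋃ j, epigraph (conjugateFun (g j))) ∪ epigraph (conjugateFun (G (Sum.inr true))) ∪
            epigraph (conjugateFun (G (Sum.inr false))) := by
        ext p
        simp only [Set.mem_iUnion, Sum.exists, Bool.exists_bool, Set.mem_union, G, Sum.elim_inl]
        tauto
      rw [hunion, ← hL, ← hU]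
      exact hCC
    obtain ⟨v, r, lam, w, τ, hlam, hv, hw, hsum, hτ⟩ :=
      ((hfL.add hfU).add (convexOn_const (ℰ.fst + ℰ.snd - (f xs).fst - (f xs).snd)
        convex_univ)).exists_farkas_multipliers hG
        (by
          obtain ⟨x, hx, h1, h2⟩ := hne
          rw [NonemptyInterval.fst_sub] at h1
          rw [NonemptyInterval.snd_sub] at h2
          exact ⟨x, (hG_nonpos x).2 ⟨hx, h1, h2⟩⟩)
        hclosed
        (fun x hx => by
          obtain ⟨h1, h2, h3⟩ := (hG_nonpos x).1 hx
          exact h x h1 h2 h3)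
    obtain ⟨γ₁, hγ₁, hγ₁', hw₁⟩ := exists_mem_smul_epsSubdifferential hfL
      (hlam (Sum.inr true)) (hw (Sum.inr true)) xs
    obtain ⟨γ₂, hγ₂, hγ₂', hw₂⟩ := exists_mem_smul_epsSubdifferential hfU
      (hlam (Sum.inr false)) (hw (Sum.inr false)) xs
    -- The shifted sum takes the value `ε^L + ε^U` at `xs`, so this tolerance is the gap of the
    -- minorant.
    have hv₀ : v ∈ epsSubdifferential (r + (ℰ.fst + ℰ.snd) - inner ℝ v xs)
        (fun x => (f x).fst + (f x).snd) xs := fun x => by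
      have := hv x
      simp only [Pi.add_apply] at this
      rw [inner_sub_right]
      linarith
    have hw_g : ∀ j x, inner ℝ (w (Sum.inl j)) x - τ (Sum.inl j) ≤ lam (Sum.inl j) * g j x :=
      fun j => hw (Sum.inl j)
    have hv_xs := hv xs
    simp only [Pi.add_apply] at hv_xs
    rw [Fintype.sum_sum_type, Fintype.sum_bool] at hsum hτ
    refine ⟨r + (ℰ.fst + ℰ.snd) - inner ℝ v xs, γ₁, γ₂, lam (Sum.inr true),
      lam (Sum.inr false), fun j => τ (Sum.inl j) + lam (Sum.inl j) * g j xs -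
        inner ℝ (w (Sum.inl j)) xs, fun j => lam (Sum.inl j), by linarith, hγ₁, hγ₂, hlam _,
      hlam _, fun j => by dsimp only; linarith [hw_g j xs], fun j => hlam _, ?_, ?_⟩
    · have hmem := Set.add_mem_add (Set.add_mem_add (Set.add_mem_add hv₀ hw₁) hw₂)
        ((Set.mem_fintype_sum _ _).2 ⟨fun j => w (Sum.inl j),
          fun j => mem_epsSubdifferential_of_affine_le (hw_g j) xs, rfl⟩)
      convert hmem using 1
      rw [← hsum]
      abel
    -- Summing the gaps, the inner products and the constants `r`, `τ` cancel.
    · have hinner := congrArg (fun z => inner ℝ z xs) hsum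
      simp only [inner_add_left, sum_inner, inner_zero_left] at hinner
      simp only [Finset.sum_sub_distrib, Finset.sum_add_distrib]
      linarith
  · rintro ⟨ε₀, γ₁, γ₂, μ₁, μ₂, ε, lam, -, -, -, hμ₁, hμ₂, -, hlam, hmem, hle⟩ x hx h1 h2
    obtain ⟨_, ⟨_, ⟨v, hv, _, ⟨a, ha, rfl⟩, rfl⟩, _, ⟨b, hb, rfl⟩, rfl⟩, w', hw', hsum⟩ := hmem
    obtain ⟨w, hw, rfl⟩ := (Set.mem_fintype_sum _ _).1 hw'
    have h3 := hv x
    have h4 := mul_le_mul_of_nonneg_left (ha x) hμ₁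
    have h5 := mul_le_mul_of_nonneg_left (hb x) hμ₂
    have h6 := Finset.sum_le_sum fun j (_ : j ∈ Finset.univ) => hw j x
    have h7 : ∑ j, lam j * g j x ≤ 0 :=
      Finset.sum_nonpos fun j _ => mul_nonpos_of_nonneg_of_nonpos (hlam j) (hx j)
    have h8 := congrArg (fun z => inner ℝ z (x - xs)) hsum
    simp only [inner_add_left, real_inner_smul_left, sum_inner, inner_zero_left] at h8
    simp only [Finset.sum_sub_distrib] at h6
    have h9 := mul_nonneg hμ₁ (sub_nonneg.2 h1)
    have h10 := mul_nonneg hμ₂ (sub_nonneg.2 h2)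
    linarith
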